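/- Let $d\in\mathbb N$, let $D\subseteq\mathbb R^d$ be open, and let $\{X(t),t\in D\}$ be a centered Gaussian field with constant variance $1$ whose covariance function $r(t_1,t_2)=\mathbf E[X(t_1)X(t_2)]$ satisfies $r(t_1,t_2)=1\Leftrightarrow t_1=t_2$. Let $\alpha\in(0,2]$, and suppose that $X$ is locally stationary with index $\alpha$ and local structure $(C_t)_{t\in D}$. This means that for each $t\in D$ the function $C_t:\mathbb R^d\to\mathbb R$ is continuous, satisfies $C_t(\lambda s)=|\lambda|^\alpha C_t(s)$ for all $\lambda\in\mathbb R$ and $s\in\mathbb R^d$, and is strictly positive on $\mathbb R^d\setminus\{0\}$; that $$\lim_{s\to0,\ s\ne0}\frac{1-r(t,t+s)}{C_t(s)}=1$$ uniformly in $t$ on compact subsets of $D$; and that $t\mapsto C_t$ is continuous on $D$ with respect to uniform convergence on the unit sphere $\mathbb S^{d-1}$. Then for each $t\in D$ the following hold. 1. The function $C_t$ is negative definite: it is continuous, $C_t(-s)=C_t(s)$ for all $s\in\mathbb R^d$, $C_t(0)=0$, and for all $n$ and all $s_1,\dots,s_n\in\mathbb R^d$ the matrix $\bigl(C_t(s_i)+C_t(s_j)-C_t(s_i-s_j)\bigr)_{i,j=1,\dots,n}$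 is positive semidefinite. 2. There exists a finite Borel measure $\Gamma_t$ on $\mathbb S^{d-1}$ such that $$C_t(s)=\int_{\mathbb S^{d-1}}|(s,x)|^\alpha\,d\Gamma_t(x)\qquad\text{for all } s\in\mathbb R^d,$$ where $(\cdot,\cdot)$ is the Euclidean inner product, and the support of $\Gamma_t$ is not contained in any proper linear subspace of $\mathbb R^d$. -/

import Mathlib

open MeasureTheory ProbabilityTheory Filter Topology Metric

/-- A function on a real vector space is homogeneous of order `α` if `f (c s) = |c|^α f s` for all
real `c` and all `s`. -/
def IsHomogeneousOfOrder {E : Type*} [AddCommGroup E] [Module ℝ E] (α : ℝ) (f : E → ℝ) : Prop :=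
  ∀ (s : E) (c : ℝ), f (c • s) = |c| ^ α * f s

/-- The cone `H⁺(α)` of continuous functions on `ℝ^d` which are homogeneous of order `α` and
strictly positive (away from the origin, where every homogeneous function of positive order
vanishes). -/
structure MemHPlus {d : ℕ} (α : ℝ) (f : EuclideanSpace ℝ (Fin d) → ℝ) : Prop where
  continuous : Continuous f
  homogeneous : IsHomogeneousOfOrder α f
  pos : ∀ s, s ≠ 0 → 0 < f s

/-- A continuous even function on `ℝ^d` vanishing at the origin is negative definite if all matrices
`(f (s i) + f (s j) - f (s i - s j))` are positive semidefinite. -/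
structure IsNegativeDefinite {d : ℕ} (f : EuclideanSpace ℝ (Fin d) → ℝ) : Prop where
  continuous : Continuous f
  even : ∀ s, f (-s) = f s
  map_zero : f 0 = 0
  posSemidef : ∀ (n : ℕ) (s : Fin n → EuclideanSpace ℝ (Fin d)),
    (Matrix.of fun i j => f (s i) + f (s j) - f (s i - s j)).PosSemidef

/-- The covariance function `r(t₁, t₂) = E[X(t₁) X(t₂)]` of a centered field. -/
noncomputable def covFun {Ω T : Type*} [MeasurableSpace Ω] (P : Measure Ω) (X : T → Ω → ℝ)
    (t₁ t₂ : T) : ℝ :=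
  ∫ ω, X t₁ ω * X t₂ ω ∂P

/-- `X` is a locally stationary Gaussian field on `D` with index `α` and local structure `C`. -/
structure IsLocallyStationary {Ω : Type*} [MeasurableSpace Ω] (P : Measure Ω) {d : ℕ}
    {D : Set (EuclideanSpace ℝ (Fin d))} (X : D → Ω → ℝ) (α : ℝ)
    (C : D → EuclideanSpace ℝ (Fin d) → ℝ) : Prop where
  gaussian : IsGaussianProcess X P
  centered : ∀ t, ∫ ω, X t ω ∂P = 0
  variance_one : ∀ t, Var[X t; P] = 1
  cov_eq_one_iff : ∀ t₁ t₂, covFun P X t₁ t₂ = 1 ↔ t₁ = t₂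
  index_pos : 0 < α
  index_le_two : α ≤ 2
  memHPlus : ∀ t, MemHPlus α (C t)
  /-- `(1 - r(t, t + s)) / C_t(s) → 1` as `s → 0`, `s ≠ 0`, uniformly in `t` on compact subsets
  of `D`. -/
  tendsto_one : ∀ K : Set D, IsCompact K → ∀ ε > 0, ∃ δ > 0, ∀ t ∈ K,
    ∀ (s : EuclideanSpace ℝ (Fin d)) (hs : (t : EuclideanSpace ℝ (Fin d)) + s ∈ D),
      s ≠ 0 → ‖s‖ < δ → |(1 - covFun P X t ⟨t + s, hs⟩) / C t s - 1| < ε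
  /-- `t ↦ C_t` is continuous for the norm of uniform convergence on the unit sphere. -/
  continuous_structure : ∀ t, TendstoUniformlyOn C (C t) (𝓝 t) (sphere 0 1)

/-! Negative definiteness is inherited from the field. The Gram matrix of the increments `X (t + ε
sᵢ) - X t` is positive semidefinite, and its entries are combinations of values of `1 - r`. Divided
by `ε ^ α` they converge to `C t (s i) + C t (s j) - C t (s i - s j)`
(`IsLocallyStationary.tendsto_cov`).

For the spectral measure, write `f = C t`. By Schoenberg's theorem `exp (-f)` is positive definite;
positivity and homogeneity of `f` make it integrable, so Bochner's theorem gives a symmetric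
`α`-stable law `μ` with this characteristic function. For `β < α`, integrating `1 - cos` against `l
^ (-1 - β)` turns characteristic functions into absolute moments, and `f s ^ (β / α)` is a constant
times `∫ |⟨s, x⟩| ^ β ∂μ`. Radial projection of `μ` with weight proportional to `‖x‖ ^ β` gives a
measure on the sphere representing `f ^ (β / α)`. These measures have bounded mass, so a weak limit
as `β ↑ α` exists and represents `f`. The order `β = α` is out of direct reach: the moment identity
breaks down there.

Finally, a support inside a proper subspace would force `f` to vanish at a nonzero vector orthogonal
to it. -/

/-- Positive semidefiniteness is preserved by entrywise limits. -/
theorem Matrix.PosSemidef.of_tendsto {ι n : Type*} [Fintype n] {l : Filter ι} [l.NeBot]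
    {A : ι → Matrix n n ℝ} {B : Matrix n n ℝ} (hA : ∀ᶠ k in l, (A k).PosSemidef)
    (h : ∀ i j, Tendsto (fun k => A k i j) l (𝓝 (B i j))) : B.PosSemidef := by
  have hAB : Tendsto A l (𝓝 B) := tendsto_pi_nhds.2 fun i => tendsto_pi_nhds.2 fun j => h i j
  refine .of_dotProduct_mulVec_nonneg ?_ fun x => ?_
  · ext i j
    refine tendsto_nhds_unique_of_eventuallyEq (h j i) (h i j) ?_
    filter_upwards [hA] with k hk
    simpa using hk.1.apply i j
  · have hc : Continuous fun M : Matrix n n ℝ => star x ⬝ᵥ (M.mulVec x) := by fun_prop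
    refine ge_of_tendsto ((hc.tendsto B).comp hAB) ?_
    filter_upwards [hA] with k hk
    exact hk.dotProduct_mulVec_nonneg x

theorem posSemidef_gram_integral {Ω n : Type*} [Fintype n] [MeasurableSpace Ω] (P : Measure Ω)
    {Y : n → Ω → ℝ} (hY : ∀ i, MemLp (Y i) 2 P) :
    (Matrix.of fun i j => ∫ ω, Y i ω * Y j ω ∂P).PosSemidef := by
  refine .of_dotProduct_mulVec_nonneg ?_ fun x => ?_
  · ext i j
    simp [mul_comm]
  · have hint : ∀ i j, Integrable (fun ω => x i * (Y i ω * Y j ω * x j)) P := fun i j =>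
      (((hY i).integrable_mul (hY j)).mul_const _).const_mul _
    have : star x ⬝ᵥ ((Matrix.of fun i j => ∫ ω, Y i ω * Y j ω ∂P).mulVec x)
        = ∫ ω, (∑ i, x i * Y i ω) ^ 2 ∂P := by
      have e : ∀ ω, (∑ i, x i * Y i ω) ^ 2 = ∑ i, ∑ j, x i * (Y i ω * Y j ω * x j) := fun ω => by
        rw [sq, Finset.sum_mul_sum]
        exact Finset.sum_congr rfl fun i _ => Finset.sum_congr rfl fun j _ => by ring
      simp_rw [e]
      rw [integral_finsetSum _ fun i _ => integrable_finsetSum _ fun j _ => hint i j]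
      simp only [dotProduct, Matrix.mulVec, Matrix.of_apply, Pi.star_apply, star_trivial]
      refine Finset.sum_congr rfl fun i _ => ?_
      rw [integral_finsetSum _ fun j _ => hint i j, Finset.mul_sum]
      refine Finset.sum_congr rfl fun j _ => ?_
      rw [integral_const_mul, integral_mul_const]
    rw [this]
    exact integral_nonneg fun ω => sq_nonneg _

theorem IsHomogeneousOfOrder.map_zero {E : Type*} [AddCommGroup E] [Module ℝ E] {α : ℝ} {f : E → ℝ}
    (hf : IsHomogeneousOfOrder α f) (hα : 0 < α) : f 0 = 0 := by
  simpa [Real.zero_rpow hα.ne'] using hf 0 0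

theorem IsHomogeneousOfOrder.map_neg {E : Type*} [AddCommGroup E] [Module ℝ E] {α : ℝ} {f : E → ℝ}
    (hf : IsHomogeneousOfOrder α f) (s : E) : f (-s) = f s := by
  simpa using hf s (-1)

/-! ### Negative definiteness of the local structure -/

section LocallyStationary

variable {Ω : Type*} [MeasurableSpace Ω] {P : Measure Ω} {d : ℕ}
  {D : Set (EuclideanSpace ℝ (Fin d))} {X : D → Ω → ℝ} {α : ℝ}
  {C : D → EuclideanSpace ℝ (Fin d) → ℝ}

theorem IsLocallyStationary.memLp (hX : IsLocallyStationary P X α C) (t : D) :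
    MemLp (X t) 2 P :=
  (hX.gaussian.hasGaussianLaw_eval t).memLp_two

/-- This is the Gram matrix of the increments `X (t i) - X t₀` in `L²`, expanded with `E[X t₀ ²] =
1`. -/
theorem IsLocallyStationary.posSemidef_increments (hX : IsLocallyStationary P X α C) {n : ℕ}
    (t₀ : D) (t : Fin n → D) :
    (Matrix.of fun i j => (1 - covFun P X t₀ (t i)) + (1 - covFun P X t₀ (t j))
      - (1 - covFun P X (t j) (t i))).PosSemidef := by
  have h := posSemidef_gram_integral P (Y := fun i ω => X (t i) ω - X t₀ ω)
    fun i => (hX.memLp (t i)).sub (hX.memLp t₀)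
  convert! h using 1
  ext i j
  simp only [Matrix.of_apply]
  have hi : ∀ a b, Integrable (fun ω => X a ω * X b ω) P := fun a b =>
    (hX.memLp a).integrable_mul (hX.memLp b)
  have h1 : ∫ ω, X t₀ ω * X t₀ ω ∂P = 1 := (hX.cov_eq_one_iff t₀ t₀).2 rfl
  have e : ∀ ω, (X (t i) ω - X t₀ ω) * (X (t j) ω - X t₀ ω)
      = X (t j) ω * X (t i) ω - X t₀ ω * X (t i) ω - X t₀ ω * X (t j) ω + X t₀ ω * X t₀ ω :=
    fun ω => by ring
  simp_rw [e]
  have i1 := (hi (t j) (t i)).sub (hi t₀ (t i))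
  have i2 := i1.sub (hi t₀ (t j))
  simp only [Pi.sub_def] at i1 i2
  rw [integral_add i2 (hi _ _), integral_sub i1 (hi _ _), integral_sub (hi _ _) (hi _ _), h1]
  simp only [covFun]
  ring

theorem IsLocallyStationary.tendsto_structure (hX : IsLocallyStationary P X α C) (t : D)
    (s : EuclideanSpace ℝ (Fin d)) : Tendsto (fun u => C u s) (𝓝 t) (𝓝 (C t s)) := by
  rcases eq_or_ne s 0 with rfl | hs
  · simp [fun u => (hX.memHPlus u).homogeneous.map_zero hX.index_pos]
  have hs' : ‖s‖ ≠ 0 := norm_ne_zero_iff.2 hs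
  have e : ∀ u, C u s = |‖s‖| ^ α * C u (‖s‖⁻¹ • s) := fun u => by
    rw [← (hX.memHPlus u).homogeneous, smul_smul, mul_inv_cancel₀ hs', one_smul]
  simp_rw [e]
  refine Tendsto.const_mul _ ((hX.continuous_structure t).tendsto_at ?_)
  simp [norm_smul, hs']

/-- The covariance at two points approaching `t` along fixed directions. The map `p` extends the
identity of `D` to the whole space. -/
theorem IsLocallyStationary.tendsto_cov (hX : IsLocallyStationary P X α C) (hD : IsOpen D) (t : D)
    {p : EuclideanSpace ℝ (Fin d) → D} (hp : ∀ x (hx : x ∈ D), p x = ⟨x, hx⟩)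
    (u v : EuclideanSpace ℝ (Fin d)) :
    Tendsto (fun ε : ℝ => (1 - covFun P X (p (t + ε • u)) (p (t + ε • v))) / ε ^ α)
      (𝓝[>] 0) (𝓝 (C t (v - u))) := by
  have hmem : ∀ w : EuclideanSpace ℝ (Fin d), ∀ᶠ ε : ℝ in 𝓝[>] 0,
      (t : EuclideanSpace ℝ (Fin d)) + ε • w ∈ D := fun w => by
    have hc : Continuous fun ε : ℝ => (t : EuclideanSpace ℝ (Fin d)) + ε • w := by fun_prop
    have := hc.tendsto 0
    simp only [zero_smul, add_zero] at this
    exact (this.mono_left nhdsWithin_le_nhds).eventually (hD.mem_nhds t.2)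
  have hpos : ∀ᶠ ε : ℝ in 𝓝[>] 0, 0 < ε := self_mem_nhdsWithin
  rcases eq_or_ne u v with rfl | huv
  · simp [fun a => (hX.cov_eq_one_iff a a).2 rfl, (hX.memHPlus t).homogeneous.map_zero hX.index_pos]
  set w := v - u with hw
  have hw0 : w ≠ 0 := sub_ne_zero.2 huv.symm
  have hpt : Tendsto (fun ε : ℝ => p (t + ε • u)) (𝓝[>] 0) (𝓝 t) := by
    rw [tendsto_subtype_rng]
    have hc : Continuous fun ε : ℝ => (t : EuclideanSpace ℝ (Fin d)) + ε • u := by fun_prop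
    have := hc.tendsto 0
    simp only [zero_smul, add_zero] at this
    refine (this.mono_left nhdsWithin_le_nhds).congr' ?_
    filter_upwards [hmem u] with ε hε
    rw [hp _ hε]
  have hCt : Tendsto (fun ε : ℝ => C (p (t + ε • u)) w) (𝓝[>] 0) (𝓝 (C t w)) :=
    (hX.tendsto_structure t w).comp hpt
  -- The base point `t + ε • u` moves with `ε`, so the pointwise limit at `t` is not enough;
  -- uniformity is used on a compact neighbourhood of `t`.
  have : LocallyCompactSpace D := hD.locallyCompactSpace
  obtain ⟨K, hK, hKt⟩ := exists_compact_mem_nhds t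
  have hratio : Tendsto (fun ε : ℝ => (1 - covFun P X (p (t + ε • u)) (p (t + ε • v))) /
      C (p (t + ε • u)) (ε • w)) (𝓝[>] 0) (𝓝 1) := by
    rw [Metric.tendsto_nhds]
    intro η hη
    obtain ⟨δ, hδ, H⟩ := hX.tendsto_one K hK η hη
    have hsmall : ∀ᶠ ε : ℝ in 𝓝[>] 0, ‖ε • w‖ < δ := by
      have hc : Continuous fun ε : ℝ => ‖ε • w‖ := by fun_prop
      have := hc.tendsto 0
      simp only [zero_smul, norm_zero] at this
      exact (this.mono_left nhdsWithin_le_nhds).eventually (gt_mem_nhds hδ)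
    filter_upwards [hmem u, hmem v, hpos, hpt.eventually hKt, hsmall] with ε h1 h2 h3 h4 h5
    have e : (t : EuclideanSpace ℝ (Fin d)) + ε • u + ε • w = t + ε • v := by
      rw [hw, smul_sub]; abel
    have h2' : ((⟨t + ε • u, h1⟩ : D) : EuclideanSpace ℝ (Fin d)) + ε • w ∈ D := by
      simpa only [e] using h2
    rw [hp _ h1] at h4
    have := H ⟨t + ε • u, h1⟩ h4 (ε • w) h2' (smul_ne_zero h3.ne' hw0) h5
    rw [Real.dist_eq, hp _ h1, hp _ h2]
    simpa only [e] using this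
  have := hratio.mul hCt
  rw [one_mul] at this
  refine this.congr' ?_
  filter_upwards [hpos] with ε hε
  have h1 := (hX.memHPlus (p (t + ε • u))).pos w hw0
  rw [(hX.memHPlus _).homogeneous, abs_of_pos hε]
  have h2 : 0 < ε ^ α := Real.rpow_pos_of_pos hε _
  field_simp

theorem IsLocallyStationary.isNegativeDefinite (hX : IsLocallyStationary P X α C) (hD : IsOpen D)
    (t : D) : IsNegativeDefinite (C t) where
  continuous := (hX.memHPlus t).continuous
  even := (hX.memHPlus t).homogeneous.map_neg
  map_zero := (hX.memHPlus t).homogeneous.map_zero hX.index_pos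
  posSemidef n s := by
    classical
    -- The default value `t` is harmless: for small `ε` all the points involved lie in the open set
    -- `D`.
    let p : EuclideanSpace ℝ (Fin d) → D := fun x => if hx : x ∈ D then ⟨x, hx⟩ else t
    have hp : ∀ x (hx : x ∈ D), p x = ⟨x, hx⟩ := fun x hx => by simp [p, hx]
    have hpos : ∀ᶠ ε : ℝ in 𝓝[>] 0, 0 < ε := self_mem_nhdsWithin
    refine Matrix.PosSemidef.of_tendsto (l := 𝓝[>] (0 : ℝ))
      (A := fun ε => (ε ^ α)⁻¹ • Matrix.of fun i j =>
        (1 - covFun P X (p (t + ε • 0)) (p (t + ε • s i)))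
        + (1 - covFun P X (p (t + ε • 0)) (p (t + ε • s j)))
        - (1 - covFun P X (p (t + ε • s j)) (p (t + ε • s i)))) ?_ fun i j => ?_
    · filter_upwards [hpos] with ε hε
      exact (hX.posSemidef_increments _ _).smul (inv_nonneg.2 (Real.rpow_nonneg hε.le _))
    · have := ((hX.tendsto_cov hD t hp 0 (s i)).add (hX.tendsto_cov hD t hp 0 (s j))).sub
        (hX.tendsto_cov hD t hp (s j) (s i))
      simp only [sub_zero] at this
      refine this.congr fun ε => ?_
      simp only [Matrix.smul_apply, Matrix.of_apply, smul_eq_mul]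
      ring

end LocallyStationary

/-! ### Schoenberg's theorem -/

open scoped Matrix in
/-- The entrywise exponential of a positive semidefinite matrix is positive semidefinite. -/
theorem Matrix.PosSemidef.entrywise_exp {n : Type*} [Fintype n] {A : Matrix n n ℝ}
    (hA : A.PosSemidef) : (A.map Real.exp).PosSemidef := by
  have hrank : (Matrix.vecMulVec (1 : n → ℝ) (star 1)).PosSemidef :=
    Matrix.posSemidef_vecMulVec_self_star _
  have hpow : ∀ (B : Matrix n n ℝ), B.PosSemidef → ∀ k : ℕ,
      (Matrix.of fun i j => B i j ^ k).PosSemidef := fun B hB k => by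
    induction k with
    | zero =>
      convert! hrank using 1
      ext i j
      simp
    | succ k ih =>
      convert! ih.hadamard hB using 1
  -- The exponential is the limit of `(1 + A i j / k) ^ k`. The base is the all-ones matrix plus a
  -- multiple of `A`, and entrywise powers are handled by the Schur product theorem.
  refine Matrix.PosSemidef.of_tendsto (l := atTop)
    (A := fun k : ℕ => Matrix.of fun i j => (1 + A i j / k) ^ k) (.of_forall fun k => ?_)
    fun i j => Real.tendsto_one_add_div_pow_exp (A i j)
  refine hpow (Matrix.of fun i j => 1 + A i j / k) ?_ k
  convert! hrank.add (hA.smul (inv_nonneg.2 (Nat.cast_nonneg (α := ℝ) k))) using 1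
  ext i j
  simp [div_eq_inv_mul]

open scoped Matrix in
/-- **Schoenberg's theorem**: the exponential of the opposite of a negative definite function is
positive definite. -/
theorem IsNegativeDefinite.posSemidef_exp_neg {d : ℕ} {f : EuclideanSpace ℝ (Fin d) → ℝ}
    (hf : IsNegativeDefinite f) (n : ℕ) (s : Fin n → EuclideanSpace ℝ (Fin d)) :
    (Matrix.of fun i j => Real.exp (-f (s i - s j))).PosSemidef := by
  -- Uses `exp (-f (sᵢ - sⱼ)) = exp (f sᵢ + f sⱼ - f (sᵢ - sⱼ)) * (exp (-f sᵢ) * exp (-f sⱼ))`,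
  -- whose last factor is a rank-one matrix.
  convert! (hf.posSemidef n s).entrywise_exp.hadamard
    (Matrix.posSemidef_vecMulVec_self_star fun i => Real.exp (-f (s i))) using 1
  ext i j
  simp only [Matrix.of_apply, Matrix.hadamard_apply, Matrix.map_apply, Matrix.vecMulVec_apply,
    star_trivial, ← Real.exp_add]
  congr 1
  ring

/-! ### Bochner's theorem for integrable functions -/

/-- A kernel all of whose finite double sums are nonnegative has a nonnegative double integral. -/
theorem integral_integral_nonneg_of_sum_nonneg {E : Type*} [MeasurableSpace E] (μ : Measure E)
    [IsProbabilityMeasure μ] {K : E → E → ℝ} (hK : Measurable (Function.uncurry K)) {B : ℝ}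
    (hB : ∀ x y, |K x y| ≤ B) (h : ∀ (n : ℕ) (s : Fin n → E), 0 ≤ ∑ i, ∑ j, K (s i) (s j)) :
    0 ≤ ∫ x, ∫ y, K x y ∂μ ∂μ := by
  set I := ∫ x, ∫ y, K x y ∂μ ∂μ with hI
  have hIp : ∫ z, Function.uncurry K z ∂(μ.prod μ) = I :=
    integral_prod _ (Integrable.of_bound hK.aestronglyMeasurable B (.of_forall fun z => hB _ _))
  -- Average the double sum over `n` independent points of law `μ`: each of the `n (n - 1)`
  -- off-diagonal terms contributes `I`, each of the `n` diagonal ones at most `B`. Hence `0 ≤ n (n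
  -- - 1) I + n B`, which fails for large `n` if `I < 0`.
  have key : ∀ n : ℕ, -(n * B) ≤ n * n * I - n * I := fun n => by
    let ν : Measure (Fin n → E) := Measure.pi fun _ => μ
    have hmeas : ∀ i j, Measurable fun s : Fin n → E => K (s i) (s j) := fun i j =>
      hK.comp (f := fun s : Fin n → E => (s i, s j)) (by fun_prop)
    have hint : ∀ i j, Integrable (fun s : Fin n → E => K (s i) (s j)) ν := fun i j =>
      Integrable.of_bound (hmeas i j).aestronglyMeasurable B (.of_forall fun s => hB _ _)
    have hind : iIndepFun (fun (i : Fin n) (s : Fin n → E) => s i) ν :=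
      iIndepFun_pi (X := fun _ => id) fun _ => aemeasurable_id
    have hoff : ∀ i j, i ≠ j → ∫ s, K (s i) (s j) ∂ν = I := fun i j hij => by
      have hmap : ν.map (fun s : Fin n → E => (s i, s j)) = μ.prod μ := by
        rw [(indepFun_iff_map_prod_eq_prod_map_map (measurable_pi_apply i).aemeasurable
          (measurable_pi_apply j).aemeasurable).1
          (hind.indepFun hij)]
        congr 1
        · exact (measurePreserving_eval (fun _ : Fin n => μ) i).map_eq
        · exact (measurePreserving_eval (fun _ : Fin n => μ) j).map_eq
      rw [← hIp, ← hmap, integral_map (by fun_prop) hK.aestronglyMeasurable]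
      rfl
    have hdiag : ∀ i, ∫ s, K (s i) (s i) ∂ν ≤ B := fun i => by
      calc ∫ s, K (s i) (s i) ∂ν ≤ ∫ _, B ∂ν :=
            integral_mono (hint i i) (integrable_const _) fun s => (abs_le.1 (hB _ _)).2
        _ = B := by simp
    have h0 : 0 ≤ ∑ i : Fin n, ∑ j : Fin n, ∫ s, K (s i) (s j) ∂ν := by
      have := integral_nonneg (μ := ν) (f := fun s : Fin n → E => ∑ i, ∑ j, K (s i) (s j)) (h n)
      rwa [integral_finsetSum _ fun i _ => integrable_finsetSum _ fun j _ => hint i j,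
        Finset.sum_congr rfl fun i _ => integral_finsetSum _ fun j _ => hint i j] at this
    have h1 : ∑ i : Fin n, ∑ j : Fin n, ∫ s, K (s i) (s j) ∂ν
        ≤ ∑ i : Fin n, ∑ j : Fin n, (I + if i = j then B - I else 0) := by
      refine Finset.sum_le_sum fun i _ => Finset.sum_le_sum fun j _ => ?_
      by_cases hij : i = j
      · subst hij
        simpa using hdiag i
      · simp [hij, hoff i j hij]
    have h2 : ∑ i : Fin n, ∑ j : Fin n, (I + if i = j then B - I else 0)
        = n * n * I + n * (B - I) := by
      simp [Finset.sum_add_distrib]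
      ring
    linarith
  by_contra! hneg
  obtain ⟨n, hn⟩ := exists_nat_gt (B / -I + 1)
  have h3 : B / -I < n - 1 := by linarith
  rw [div_lt_iff₀ (by linarith)] at h3
  have hn0 : (0 : ℝ) < n := by
    have h4 : 0 ≤ B := (abs_nonneg _).trans (hB (Classical.choice μ.nonempty_of_neZero)
      (Classical.choice μ.nonempty_of_neZero))
    have : 0 ≤ B / -I := div_nonneg h4 (by linarith)
    linarith
  have := key n
  nlinarith [mul_pos hn0 (sub_pos.2 h3)]

section Bochner

variable {E : Type*} [NormedAddCommGroup E] [InnerProductSpace ℝ E] [FiniteDimensional ℝ E]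
  [MeasurableSpace E] [BorelSpace E]

theorem integrable_exp_neg_mul_norm_sq {a : ℝ} (ha : 0 < a) :
    Integrable fun x : E => Real.exp (-a * ‖x‖ ^ 2) := by
  have := (GaussianFourier.integrable_cexp_neg_mul_sq_norm_add (V := E) (b := (a : ℂ))
    (by simpa using ha) 0 0).norm
  refine this.congr (.of_forall fun x => ?_)
  simp [Complex.norm_exp, ← Complex.ofReal_pow, ← Complex.ofReal_mul]

/-- Apply the double integral inequality to the Gaussian law with density proportional to `exp (-a
‖x‖²)`. The difference of two independent such points has density proportional to `exp (-(a / 2)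
‖u‖²)`. -/
theorem integral_mul_gaussian_nonneg {K : E → ℝ} (hK : Continuous K) {B : ℝ}
    (hB : ∀ x, |K x| ≤ B) (hint : Integrable K)
    (h : ∀ (n : ℕ) (s : Fin n → E), 0 ≤ ∑ i, ∑ j, K (s i - s j)) {a : ℝ} (ha : 0 < a) :
    0 ≤ ∫ u, K u * Real.exp (-(a / 2) * ‖u‖ ^ 2) := by
  set g : E → ℝ := fun x => Real.exp (-a * ‖x‖ ^ 2) with hg
  have hgc : Continuous g := by fun_prop
  have hgi : Integrable g := integrable_exp_neg_mul_norm_sq ha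
  have hg0 : ∀ x, 0 < g x := fun x => Real.exp_pos _
  have hg1 : ∀ x, g x ≤ 1 := fun x => Real.exp_le_one_iff.2 (by nlinarith [sq_nonneg ‖x‖])
  have hpos : ∀ {b : ℝ}, 0 < b → 0 < ∫ x : E, Real.exp (-b * ‖x‖ ^ 2) := fun hb =>
    integral_exp_pos (integrable_exp_neg_mul_norm_sq hb)
  set c := ∫ x, g x with hc
  have hc0 : 0 < c := hpos ha
  let μ : Measure E := volume.withDensity fun x => ENNReal.ofReal (c⁻¹ * g x)
  have : IsProbabilityMeasure μ := ⟨by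
    rw [withDensity_apply _ MeasurableSet.univ, setLIntegral_univ,
      ← ofReal_integral_eq_lintegral_ofReal (hgi.const_mul _)
        (.of_forall fun x => (mul_pos (inv_pos.2 hc0) (hg0 x)).le), integral_const_mul, ← hc,
      inv_mul_cancel₀ hc0.ne', ENNReal.ofReal_one]⟩
  have hμ : ∀ F : E → ℝ, ∫ x, F x ∂μ = c⁻¹ * ∫ x, g x * F x := fun F => by
    rw [integral_withDensity_eq_integral_toReal_smul (by fun_prop) (.of_forall fun _ => by simp),
      ← integral_const_mul]
    refine integral_congr_ae (.of_forall fun x => ?_)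
    simp only [ENNReal.toReal_ofReal (mul_pos (inv_pos.2 hc0) (hg0 x)).le, smul_eq_mul, mul_assoc]
  have h1 := integral_integral_nonneg_of_sum_nonneg μ (K := fun x y => K (y - x))
    (by fun_prop) (fun x y => hB _) fun n s => by rw [Finset.sum_comm]; exact h n s
  simp only [hμ] at h1
  have h2 : ∫ x, g x * (c⁻¹ * ∫ y, g y * K (y - x))
      = c⁻¹ * ∫ x, ∫ u, g x * (g (u + x) * K u) := by
    rw [← integral_const_mul]
    refine integral_congr_ae (.of_forall fun x => ?_)
    simp only
    rw [← integral_add_right_eq_self (fun y => g y * K (y - x)) x, integral_const_mul]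
    simp only [add_sub_cancel_right]
    ring
  have h3 : ∫ x, ∫ u, g x * (g (u + x) * K u) = ∫ u, ∫ x, g x * (g (u + x) * K u) := by
    refine integral_integral_swap ?_
    refine Integrable.mono' (hgi.mul_prod hint.norm) (by fun_prop) (.of_forall fun z => ?_)
    simp only [Function.uncurry, norm_mul, Real.norm_eq_abs, abs_of_pos (hg0 _)]
    have := mul_le_of_le_one_left (abs_nonneg (K z.2)) (hg1 (z.2 + z.1))
    exact mul_le_mul_of_nonneg_left this (hg0 _).le
  have h4 : ∀ u, ∫ x, g x * (g (u + x) * K u)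
      = (∫ x : E, Real.exp (-(2 * a) * ‖x‖ ^ 2)) * (K u * Real.exp (-(a / 2) * ‖u‖ ^ 2)) :=
    fun u => by
    -- Centring at `-u / 2` decouples the variables: `‖x - u / 2‖² + ‖x + u / 2‖² = 2 ‖x‖² + ‖u‖² /
    -- 2`.
    rw [← integral_add_right_eq_self _ (-((2⁻¹ : ℝ) • u)), ← integral_mul_const]
    refine integral_congr_ae (.of_forall fun x => ?_)
    simp only [hg]
    have e : -a * ‖x + -((2⁻¹ : ℝ) • u)‖ ^ 2 + -a * ‖u + (x + -((2⁻¹ : ℝ) • u))‖ ^ 2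
        = -(2 * a) * ‖x‖ ^ 2 + -(a / 2) * ‖u‖ ^ 2 := by
      have e1 : u + (x + -((2⁻¹ : ℝ) • u)) = x + (2⁻¹ : ℝ) • u := by module
      rw [e1, ← sub_eq_add_neg, norm_add_sq_real, norm_sub_sq_real, norm_smul, Real.norm_eq_abs,
        abs_of_pos (by norm_num : (0 : ℝ) < 2⁻¹)]
      ring
    rw [← mul_assoc, ← Real.exp_add, e, Real.exp_add]
    ring
  rw [h2, h3] at h1
  simp only [h4, integral_const_mul] at h1
  have hp := hpos (b := 2 * a) (by linarith)
  have hci := inv_pos.2 hc0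
  exact nonneg_of_mul_nonneg_right (nonneg_of_mul_nonneg_right (nonneg_of_mul_nonneg_right h1 hci)
    hci) hp

theorem integral_nonneg_of_sum_nonneg {K : E → ℝ} (hK : Continuous K) {B : ℝ}
    (hB : ∀ x, |K x| ≤ B) (hint : Integrable K)
    (h : ∀ (n : ℕ) (s : Fin n → E), 0 ≤ ∑ i, ∑ j, K (s i - s j)) : 0 ≤ ∫ u, K u := by
  have hpos : ∀ᶠ a : ℝ in 𝓝[>] 0, 0 < a := self_mem_nhdsWithin
  have hlim : Tendsto (fun a : ℝ => ∫ u, K u * Real.exp (-(a / 2) * ‖u‖ ^ 2)) (𝓝[>] 0)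
      (𝓝 (∫ u, K u)) := by
    refine tendsto_integral_filter_of_dominated_convergence (fun u => ‖K u‖)
      (.of_forall fun a => by fun_prop) ?_ hint.norm (.of_forall fun u => ?_)
    · filter_upwards [hpos] with a ha
      refine .of_forall fun u => ?_
      rw [norm_mul]
      refine mul_le_of_le_one_right (norm_nonneg _) ?_
      rw [Real.norm_eq_abs, Real.abs_exp]
      exact Real.exp_le_one_iff.2 (by nlinarith [sq_nonneg ‖u‖])
    · have hc : Continuous fun a : ℝ => K u * Real.exp (-(a / 2) * ‖u‖ ^ 2) := by fun_prop
      have := hc.tendsto 0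
      simp only [zero_div, neg_zero, zero_mul, Real.exp_zero, mul_one] at this
      exact this.mono_left nhdsWithin_le_nhds
  refine ge_of_tendsto hlim ?_
  filter_upwards [hpos] with a ha
  exact integral_mul_gaussian_nonneg hK hB hint h ha

end Bochner

section Bochner

variable {E : Type*} [NormedAddCommGroup E] [InnerProductSpace ℝ E] [FiniteDimensional ℝ E]
  [MeasurableSpace E] [BorelSpace E]

theorem MeasureTheory.Integrable.mul_of_abs_le_one {X : Type*} [MeasurableSpace X] {μ : Measure X} {f g : X → ℝ}
    (hf : Integrable f μ) (hg : AEStronglyMeasurable g μ) (h : ∀ x, |g x| ≤ 1) :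
    Integrable (fun x => f x * g x) μ :=
  hf.mul_bdd (c := 1) hg (.of_forall h)

open scoped FourierTransform in
theorem fourier_ofReal_of_even {φ : E → ℝ} (hint : Integrable φ) (heven : ∀ x, φ (-x) = φ x)
    (w : E) : 𝓕 (fun v => (φ v : ℂ)) w
      = ((∫ v, φ v * Real.cos (2 * Real.pi * inner ℝ v w) : ℝ) : ℂ) := by
  have hc : Integrable fun v => φ v * Real.cos (2 * Real.pi * inner ℝ v w) :=
    hint.mul_of_abs_le_one (by fun_prop) fun v => Real.abs_cos_le_one _
  have hs : Integrable fun v => φ v * Real.sin (2 * Real.pi * inner ℝ v w) :=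
    hint.mul_of_abs_le_one (by fun_prop) fun v => Real.abs_sin_le_one _
  have h0 : ∫ v, φ v * Real.sin (2 * Real.pi * inner ℝ v w) = 0 := by
    have := integral_neg_eq_self (fun v => φ v * Real.sin (2 * Real.pi * inner ℝ v w)) volume
    simp only [heven, inner_neg_left, mul_neg, Real.sin_neg, integral_neg] at this
    linarith
  have e : ∀ v, Complex.exp (((-2 * Real.pi * inner ℝ v w : ℝ) : ℂ) * Complex.I) • (φ v : ℂ)
      = ((φ v * Real.cos (2 * Real.pi * inner ℝ v w) : ℝ) : ℂ)
        - Complex.I * ((φ v * Real.sin (2 * Real.pi * inner ℝ v w) : ℝ) : ℂ) := fun v => by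
    have : (-2 * Real.pi * inner ℝ v w : ℝ) = -(2 * Real.pi * inner ℝ v w) := by ring
    rw [this, Complex.exp_mul_I, ← Complex.ofReal_cos, ← Complex.ofReal_sin, Real.cos_neg,
      Real.sin_neg]
    push_cast
    simp only [smul_eq_mul]
    ring
  rw [Real.fourier_eq']
  simp_rw [e]
  rw [integral_sub hc.ofReal (hs.ofReal.const_mul _), integral_const_mul, integral_complex_ofReal,
    integral_complex_ofReal, h0]
  simp

/-- The Fourier transform of an integrable continuous positive definite function is nonnegative. -/
theorem integral_mul_cos_nonneg {φ : E → ℝ} (hφ : Continuous φ) {B : ℝ} (hB : ∀ x, |φ x| ≤ B)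
    (hint : Integrable φ)
    (h : ∀ (n : ℕ) (s : Fin n → E), (Matrix.of fun i j => φ (s i - s j)).PosSemidef) (w : E) :
    0 ≤ ∫ v, φ v * Real.cos (2 * Real.pi * inner ℝ v w) := by
  refine integral_nonneg_of_sum_nonneg (B := B) (by fun_prop) (fun x => ?_)
    (hint.mul_of_abs_le_one (by fun_prop) fun v => Real.abs_cos_le_one _) fun n s => ?_
  · rw [abs_mul]
    exact (mul_le_of_le_one_right (abs_nonneg _) (Real.abs_cos_le_one _)).trans (hB x)
  -- Since `cos (a - b) = cos a cos b + sin a sin b`, the double sum splits into two quadratic forms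
  -- of the matrix `φ (sᵢ - sⱼ)`.
  · have h1 := (h n s).dotProduct_mulVec_nonneg fun i => Real.cos (2 * Real.pi * inner ℝ (s i) w)
    have h2 := (h n s).dotProduct_mulVec_nonneg fun i => Real.sin (2 * Real.pi * inner ℝ (s i) w)
    refine (add_nonneg h1 h2).trans_eq ?_
    simp only [dotProduct, Matrix.mulVec, Matrix.of_apply, Pi.star_apply, star_trivial,
      ← Finset.sum_add_distrib, Finset.mul_sum]
    refine Finset.sum_congr rfl fun i _ => Finset.sum_congr rfl fun j _ => ?_
    rw [inner_sub_left, mul_sub, Real.cos_sub]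
    ring

open scoped FourierTransform in
-- Moving the Fourier transform onto the Gaussian yields an approximate identity at the origin.
-- Integrability of `𝓕 φ` is not assumed, because this limit serves to prove it.
theorem tendsto_integral_gaussian_mul_fourier {φ : E → ℂ} (hφ : Continuous φ)
    (hint : Integrable φ) :
    Tendsto (fun c : ℝ => ∫ w, Complex.exp (-c⁻¹ * ‖w‖ ^ 2) • 𝓕 φ w) atTop (𝓝 (φ 0)) := by
  refine (Real.tendsto_integral_gaussian_smul' hint (v := 0) hφ.continuousAt).congr' ?_
  filter_upwards [Ioi_mem_atTop 0] with c (hc : 0 < c)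
  have J : Integrable (fun w : E => Complex.exp (-c⁻¹ * ‖w‖ ^ 2)) := by
    simpa using GaussianFourier.integrable_cexp_neg_mul_sq_norm_add (V := E) (b := (c : ℂ)⁻¹)
      (by simpa) 0 0
  have := (VectorFourier.integral_fourierIntegral_smul_eq_flip (L := innerₗ E)
      Real.continuous_fourierChar continuous_inner J hint)
  have e : ∫ w, 𝓕 (fun w : E => Complex.exp (-c⁻¹ * ‖w‖ ^ 2)) w • φ w
      = ∫ w, Complex.exp (-c⁻¹ * ‖w‖ ^ 2) • 𝓕 φ w := by
    simpa using! this
  rw [← e]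
  refine integral_congr_ae (.of_forall fun w => ?_)
  beta_reduce
  rw [fourier_gaussian_innerProductSpace (by simpa)]
  simp only [Complex.ofReal_inv, div_inv_eq_mul, zero_sub, norm_neg]
  congr 3
  ring

/-- Fatou's lemma: the Gaussian factors tend to `1` and the damped integrals have a finite limit. -/
theorem integrable_of_tendsto_integral_gaussian {f : E → ℝ} (hf : Continuous f)
    (h0 : ∀ x, 0 ≤ f x) {B : ℝ} (hB : ∀ x, f x ≤ B) {b : ℝ}
    (h : Tendsto (fun c : ℝ => ∫ w, Real.exp (-c⁻¹ * ‖w‖ ^ 2) * f w) atTop (𝓝 b)) :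
    Integrable f := by
  refine ⟨hf.aestronglyMeasurable, ?_⟩
  rw [hasFiniteIntegral_iff_ofReal (.of_forall h0)]
  have hlim : ∀ w, Tendsto (fun n : ℕ => ENNReal.ofReal (Real.exp (-(n : ℝ)⁻¹ * ‖w‖ ^ 2) * f w))
      atTop (𝓝 (ENNReal.ofReal (f w))) := fun w => by
    refine ENNReal.tendsto_ofReal ?_
    have := (((tendsto_inv_atTop_zero.comp (tendsto_natCast_atTop_atTop (R := ℝ))).neg.mul_const
      (‖w‖ ^ 2)).rexp).mul_const (f w)
    simpa using this
  have hev : ∀ᶠ n : ℕ in atTop, ∫⁻ w, ENNReal.ofReal (Real.exp (-(n : ℝ)⁻¹ * ‖w‖ ^ 2) * f w)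
      = ENNReal.ofReal (∫ w, Real.exp (-(n : ℝ)⁻¹ * ‖w‖ ^ 2) * f w) := by
    filter_upwards [eventually_gt_atTop 0] with n hn
    have hn' : (0 : ℝ) < (n : ℝ)⁻¹ := by positivity
    rw [ofReal_integral_eq_lintegral_ofReal]
    · exact (integrable_exp_neg_mul_norm_sq hn').mul_bdd (c := B) hf.aestronglyMeasurable
        (.of_forall fun x => by rw [Real.norm_eq_abs, abs_of_nonneg (h0 x)]; exact hB x)
    · exact .of_forall fun x => mul_nonneg (Real.exp_pos _).le (h0 x)
  have hlim2 : Tendsto (fun n : ℕ =>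
      ∫⁻ w, ENNReal.ofReal (Real.exp (-(n : ℝ)⁻¹ * ‖w‖ ^ 2) * f w)) atTop
      (𝓝 (ENNReal.ofReal b)) :=
    (ENNReal.tendsto_ofReal (h.comp (tendsto_natCast_atTop_atTop (R := ℝ)))).congr'
      (hev.mono fun n hn => hn.symm)
  calc ∫⁻ w, ENNReal.ofReal (f w)
      = ∫⁻ w, liminf (fun n : ℕ => ENNReal.ofReal (Real.exp (-(n : ℝ)⁻¹ * ‖w‖ ^ 2) * f w)) atTop :=
        lintegral_congr fun w => (hlim w).liminf_eq.symm
    _ ≤ liminf (fun n : ℕ => ∫⁻ w, ENNReal.ofReal (Real.exp (-(n : ℝ)⁻¹ * ‖w‖ ^ 2) * f w)) atTop :=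
        lintegral_liminf_le fun n => by fun_prop
    _ = ENNReal.ofReal b := hlim2.liminf_eq
    _ < ⊤ := ENNReal.ofReal_lt_top

open scoped FourierTransform in
/-- **Bochner's theorem** for integrable even positive definite functions. -/
theorem exists_isProbabilityMeasure_integral_cos_eq {φ : E → ℝ} (hφ : Continuous φ)
    (hone : φ 0 = 1) (heven : ∀ x, φ (-x) = φ x) {B : ℝ} (hB : ∀ x, |φ x| ≤ B)
    (hint : Integrable φ)
    (h : ∀ (n : ℕ) (s : Fin n → E), (Matrix.of fun i j => φ (s i - s j)).PosSemidef) :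
    ∃ μ : Measure E, IsProbabilityMeasure μ ∧
      ∀ s, ∫ x, Real.cos (inner ℝ s x) ∂μ = φ s := by
  set f : E → ℝ := fun w => ∫ v, φ v * Real.cos (2 * Real.pi * inner ℝ v w) with hf
  have hf0 : ∀ w, 0 ≤ f w := integral_mul_cos_nonneg hφ hB hint h
  have hbd : ∀ v w, ‖φ v * Real.cos (2 * Real.pi * inner ℝ v w)‖ ≤ ‖φ v‖ := fun v w => by
    rw [norm_mul]
    exact mul_le_of_le_one_right (norm_nonneg _) (Real.abs_cos_le_one _)
  have hfc : Continuous f := by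
    refine continuous_of_dominated (fun w => by fun_prop)
      (fun w => .of_forall fun v => hbd v w) hint.norm (.of_forall fun v => by fun_prop)
  have hfB : ∀ w, f w ≤ ∫ v, ‖φ v‖ := fun w =>
    (le_abs_self _).trans (norm_integral_le_of_norm_le hint.norm (.of_forall fun v => hbd v w))
  have hF : 𝓕 (fun v => (φ v : ℂ)) = fun w => (f w : ℂ) :=
    funext fun w => fourier_ofReal_of_even hint heven w
  have hφc : Continuous fun v => (φ v : ℂ) := by fun_prop
  have hfi : Integrable f := by
    refine integrable_of_tendsto_integral_gaussian hfc hf0 hfB (b := 1) ?_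
    have h1 := tendsto_integral_gaussian_mul_fourier hφc hint.ofReal
    rw [hF, hone] at h1
    have h2 := (Complex.continuous_re.tendsto _).comp h1
    simp only [Complex.ofReal_one, Complex.one_re] at h2
    refine h2.congr fun c => ?_
    have e : ∀ w : E, Complex.exp (-((c⁻¹ : ℝ) : ℂ) * (‖w‖ : ℂ) ^ 2) • (f w : ℂ)
        = ((Real.exp (-c⁻¹ * ‖w‖ ^ 2) * f w : ℝ) : ℂ) := fun w => by
      push_cast
      rfl
    simp only [Function.comp_apply, e, integral_complex_ofReal, Complex.ofReal_re]
  have hinv : ∀ s, ∫ w, f w * Real.cos (2 * Real.pi * inner ℝ w s) = φ s := fun s => by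
    have h1 := congrFun (hφc.fourierInv_fourier_eq hint.ofReal (by rw [hF]; exact hfi.ofReal)) (-s)
    have hfe : ∀ w, f (-w) = f w := fun w => by simp [hf]
    rw [hF, Real.fourierInv_eq_fourier_neg, neg_neg, fourier_ofReal_of_even hfi hfe, heven] at h1
    exact_mod_cast h1
  have htot : ∫ w, f w = 1 := by simpa [hone] using hinv 0
  -- By Fourier inversion `f` is a probability density; the dilation by `2 * Real.pi` below absorbs
  -- the normalisation of the Fourier transform.
  let ν : Measure E := volume.withDensity fun w => ENNReal.ofReal (f w)
  have hν : IsProbabilityMeasure ν := ⟨by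
    rw [withDensity_apply _ MeasurableSet.univ, setLIntegral_univ,
      ← ofReal_integral_eq_lintegral_ofReal hfi (.of_forall hf0), htot, ENNReal.ofReal_one]⟩
  have hsm : Measurable fun x : E => (2 * Real.pi) • x := by fun_prop
  refine ⟨ν.map fun x => (2 * Real.pi) • x, Measure.isProbabilityMeasure_map hsm.aemeasurable,
    fun s => ?_⟩
  rw [integral_map hsm.aemeasurable (by fun_prop),
    integral_withDensity_eq_integral_toReal_smul (by fun_prop) (.of_forall fun _ => by simp),
    ← hinv s]
  refine integral_congr_ae (.of_forall fun x => ?_)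
  simp only [ENNReal.toReal_ofReal (hf0 x), smul_eq_mul, real_inner_smul_right, real_inner_comm]

end Bochner

/-! ### Absolute moments from characteristic functions -/

theorem integral_comp_mul_mul_rpow (F : ℝ → ℝ) (β : ℝ) {a : ℝ} (ha : 0 < a) :
    ∫ l in Set.Ioi (0 : ℝ), F (a * l) * l ^ (-1 - β)
      = a ^ β * ∫ l in Set.Ioi (0 : ℝ), F l * l ^ (-1 - β) := by
  have h := integral_comp_mul_left_Ioi (fun l => F l * l ^ (-1 - β)) 0 ha
  simp only [mul_zero, smul_eq_mul] at h
  have e : ∫ l in Set.Ioi (0 : ℝ), F (a * l) * (a * l) ^ (-1 - β)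
      = a ^ (-1 - β) * ∫ l in Set.Ioi (0 : ℝ), F (a * l) * l ^ (-1 - β) := by
    rw [← integral_const_mul]
    refine setIntegral_congr_fun measurableSet_Ioi fun l (hl : 0 < l) => ?_
    simp only [Real.mul_rpow ha.le hl.le]
    ring
  rw [e] at h
  have h1 : a ^ (-1 - β) * (a ^ β * a) = 1 := by
    rw [← Real.rpow_add_one ha.ne', ← Real.rpow_add ha, show -1 - β + (β + 1) = 0 by ring,
      Real.rpow_zero]
  have h2 : (a ^ β * a) * (a ^ (-1 - β) * ∫ l in Set.Ioi (0 : ℝ), F (a * l) * l ^ (-1 - β))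
      = ∫ l in Set.Ioi (0 : ℝ), F (a * l) * l ^ (-1 - β) := by
    rw [← mul_assoc, mul_comm (a ^ β * a), h1, one_mul]
  rw [← h2, h, mul_assoc, ← mul_assoc a, mul_inv_cancel₀ ha.ne', one_mul]

/-- The bound `A * l ^ γ` handles the singularity at `0`, the bound `B` the tail. -/
theorem integrableOn_mul_rpow {F : ℝ → ℝ} (hF : Measurable F) {A B β γ : ℝ} (hβ : 0 < β)
    (hβγ : β < γ) (hA : ∀ l, 0 < l → |F l| ≤ A * l ^ γ) (hB : ∀ l, 0 < l → |F l| ≤ B) :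
    IntegrableOn (fun l => F l * l ^ (-1 - β)) (Set.Ioi 0) := by
  have hm : Measurable fun l => F l * l ^ (-1 - β) := by fun_prop
  rw [← Set.Ioc_union_Ioi_eq_Ioi zero_le_one]
  refine IntegrableOn.union ?_ ?_
  · have h1 : IntegrableOn (fun l : ℝ => A * l ^ (γ - 1 - β)) (Set.Ioc 0 1) :=
      ((intervalIntegrable_iff_integrableOn_Ioc_of_le zero_le_one).1
        (intervalIntegral.intervalIntegrable_rpow' (by linarith))).const_mul A
    refine Integrable.mono' h1 hm.aestronglyMeasurable ?_
    refine (ae_restrict_iff' measurableSet_Ioc).2 (.of_forall fun l hl => ?_)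
    rw [norm_mul, Real.norm_eq_abs, Real.norm_eq_abs, abs_of_pos (Real.rpow_pos_of_pos hl.1 _)]
    refine (mul_le_mul_of_nonneg_right (hA l hl.1) (Real.rpow_nonneg hl.1.le _)).trans_eq ?_
    rw [mul_assoc, ← Real.rpow_add hl.1]
    ring_nf
  · have h1 : IntegrableOn (fun l : ℝ => B * l ^ (-1 - β)) (Set.Ioi 1) :=
      (integrableOn_Ioi_rpow_of_lt (by linarith) zero_lt_one).const_mul B
    refine Integrable.mono' h1 hm.aestronglyMeasurable ?_
    refine (ae_restrict_iff' measurableSet_Ioi).2 (.of_forall fun l (hl : 1 < l) => ?_)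
    have hl0 : 0 < l := zero_lt_one.trans hl
    rw [norm_mul, Real.norm_eq_abs, Real.norm_eq_abs, abs_of_pos (Real.rpow_pos_of_pos hl0 _)]
    exact mul_le_mul_of_nonneg_right (hB l hl0) (Real.rpow_nonneg hl0.le _)

theorem setIntegral_Ioi_mul_rpow_pos {F : ℝ → ℝ} {β : ℝ} (hF : ∀ l, 0 < l → 0 ≤ F l)
    (hF' : ∀ l, 0 < l → l < 1 → 0 < F l)
    (hint : IntegrableOn (fun l => F l * l ^ (-1 - β)) (Set.Ioi 0)) :
    0 < ∫ l in Set.Ioi (0 : ℝ), F l * l ^ (-1 - β) := by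
  rw [setIntegral_pos_iff_support_of_nonneg_ae _ hint]
  · refine lt_of_lt_of_le ?_ (measure_mono (s := Set.Ioo (0 : ℝ) 1) fun l hl =>
      ⟨(mul_pos (hF' l hl.1 hl.2) (Real.rpow_pos_of_pos hl.1 _)).ne', hl.1⟩)
    simp
  · exact (ae_restrict_iff' measurableSet_Ioi).2 (.of_forall fun l (hl : 0 < l) =>
      mul_nonneg (hF l hl) (Real.rpow_nonneg hl.le _))

theorem integrableOn_one_sub_cos_mul_rpow {β : ℝ} (hβ : 0 < β) (hβ2 : β < 2) :
    IntegrableOn (fun l => (1 - Real.cos l) * l ^ (-1 - β)) (Set.Ioi 0) := by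
  refine integrableOn_mul_rpow (A := 2⁻¹) (B := 2) (by fun_prop) hβ hβ2 (fun l hl => ?_)
    fun l hl => ?_
  · rw [abs_of_nonneg (sub_nonneg.2 (Real.cos_le_one _)), Real.rpow_two]
    linarith [Real.one_sub_sq_div_two_le_cos (x := l)]
  · rw [abs_of_nonneg (sub_nonneg.2 (Real.cos_le_one _))]
    linarith [Real.neg_one_le_cos l]

theorem integral_one_sub_cos_mul_rpow_pos {β : ℝ} (hβ : 0 < β) (hβ2 : β < 2) :
    0 < ∫ l in Set.Ioi (0 : ℝ), (1 - Real.cos l) * l ^ (-1 - β) :=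
  setIntegral_Ioi_mul_rpow_pos (F := fun l => 1 - Real.cos l)
    (fun l _ => sub_nonneg.2 (Real.cos_le_one _)) (fun l h0 h1 => by
      have := Real.cos_lt_cos_of_nonneg_of_le_pi le_rfl (by linarith [Real.pi_gt_three]) h0
      rw [Real.cos_zero] at this
      linarith) (integrableOn_one_sub_cos_mul_rpow hβ hβ2)

theorem integrableOn_one_sub_exp_mul_rpow {α β c : ℝ} (hβ : 0 < β) (hβα : β < α) (hc : 0 ≤ c) :
    IntegrableOn (fun l => (1 - Real.exp (-(c * l ^ α))) * l ^ (-1 - β)) (Set.Ioi 0) := by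
  have h0 : ∀ l : ℝ, 0 < l → 0 ≤ 1 - Real.exp (-(c * l ^ α)) := fun l hl =>
    sub_nonneg.2 (Real.exp_le_one_iff.2
      (neg_nonpos.2 (mul_nonneg hc (Real.rpow_nonneg hl.le _))))
  refine integrableOn_mul_rpow (F := fun l => 1 - Real.exp (-(c * l ^ α))) (A := c) (B := 1)
    (by fun_prop) hβ hβα (fun l hl => ?_) fun l hl => ?_
  · rw [abs_of_nonneg (h0 l hl)]
    linarith [Real.add_one_le_exp (-(c * l ^ α))]
  · rw [abs_of_nonneg (h0 l hl)]
    linarith [Real.exp_pos (-(c * l ^ α))]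

/-- This writes `|u| ^ β` as a mixture of the functions `1 - cos (l u)`, whose expectations are
known from the characteristic function. -/
theorem integral_one_sub_cos_mul_rpow (β u : ℝ) (hβ : 0 < β) :
    ∫ l in Set.Ioi (0 : ℝ), (1 - Real.cos (l * u)) * l ^ (-1 - β)
      = |u| ^ β * ∫ l in Set.Ioi (0 : ℝ), (1 - Real.cos l) * l ^ (-1 - β) := by
  rcases eq_or_ne u 0 with rfl | hu
  · simp [Real.zero_rpow hβ.ne']
  · rw [← integral_comp_mul_mul_rpow (fun l => 1 - Real.cos l) β (abs_pos.2 hu)]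
    refine setIntegral_congr_fun measurableSet_Ioi fun l (hl : 0 < l) => ?_
    rw [← Real.cos_abs (l * u), abs_mul, abs_of_pos hl, mul_comm l]

section Moments

variable {E : Type*} [NormedAddCommGroup E] [InnerProductSpace ℝ E] [FiniteDimensional ℝ E]
  [MeasurableSpace E] [BorelSpace E]

/-- The absolute moments of order `β < α` of a symmetric `α`-stable law. -/
theorem integrable_and_integral_abs_inner_rpow {μ : Measure E} [IsProbabilityMeasure μ]
    {f : E → ℝ} {α β : ℝ} (hβ : 0 < β) (hβα : β < α) (hα : α ≤ 2)
    (hf : IsHomogeneousOfOrder α f) {s : E} (hs : 0 ≤ f s)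
    (hμ : ∀ s, ∫ x, Real.cos (inner ℝ s x) ∂μ = Real.exp (-f s)) :
    Integrable (fun x => |inner ℝ s x| ^ β) μ ∧
      (∫ l in Set.Ioi (0 : ℝ), (1 - Real.cos l) * l ^ (-1 - β)) * ∫ x, |inner ℝ s x| ^ β ∂μ
        = f s ^ (β / α) * ∫ l in Set.Ioi (0 : ℝ), (1 - Real.exp (-(l ^ α))) * l ^ (-1 - β) := by
  set k := ∫ l in Set.Ioi (0 : ℝ), (1 - Real.cos l) * l ^ (-1 - β) with hk
  have hk0 : 0 < k := integral_one_sub_cos_mul_rpow_pos hβ (hβα.trans_le hα)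
  have hα0 : 0 < α := hβ.trans hβα
  let G : E → ℝ → ℝ := fun x l => (1 - Real.cos (l * inner ℝ s x)) * l ^ (-1 - β)
  have hGm : Measurable (Function.uncurry G) := by
    simp only [G, Function.uncurry_def]
    fun_prop
  have hcos : ∀ l : ℝ, Integrable (fun x => Real.cos (l * inner ℝ s x)) μ := fun l =>
    Integrable.of_bound (by fun_prop) 1 (.of_forall fun x => Real.abs_cos_le_one _)
  have hGx : ∀ l, 0 < l → ∫ x, G x l ∂μ = (1 - Real.exp (-(f s * l ^ α))) * l ^ (-1 - β) :=
    fun l hl => by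
    have h1 := hμ (l • s)
    simp only [real_inner_smul_left, hf s l, abs_of_pos hl] at h1
    simp only [G]
    rw [integral_mul_const, integral_sub (integrable_const _) (hcos l), h1]
    simp [mul_comm (f s)]
  have hG0 : ∀ x l, 0 < l → 0 ≤ G x l := fun x l hl =>
    mul_nonneg (sub_nonneg.2 (Real.cos_le_one _)) (Real.rpow_nonneg hl.le _)
  -- As `G ≥ 0`, integrability can be checked in the order where the inner integral over `μ` is
  -- explicit. Finiteness of the moment then follows from Fubini.
  have hGi : Integrable (Function.uncurry G) (μ.prod (volume.restrict (Set.Ioi 0))) := by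
    rw [integrable_prod_iff' hGm.aestronglyMeasurable]
    refine ⟨.of_forall fun l => ?_, ?_⟩
    · exact ((integrable_const (1 : ℝ)).sub (hcos l)).mul_const (l ^ (-1 - β))
    refine (integrableOn_one_sub_exp_mul_rpow hβ hβα hs).congr ?_
    refine (ae_restrict_iff' measurableSet_Ioi).2 (.of_forall fun l (hl : 0 < l) => ?_)
    beta_reduce
    rw [← hGx l hl]
    refine integral_congr_ae (.of_forall fun x => ?_)
    exact (abs_of_nonneg (hG0 x l hl)).symm
  have hGl : ∀ x, ∫ l in Set.Ioi (0 : ℝ), G x l = |inner ℝ s x| ^ β * k := fun x =>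
    integral_one_sub_cos_mul_rpow β _ hβ
  constructor
  · have h1 := hGi.integral_prod_left
    simp only [Function.uncurry_apply_pair, hGl] at h1
    simpa [hk0.ne', mul_assoc] using h1.mul_const k⁻¹
  · have h1 := integral_integral_swap hGi
    simp only [hGl, integral_mul_const] at h1
    rw [mul_comm, h1, setIntegral_congr_fun measurableSet_Ioi fun l hl => hGx l hl]
    -- When `f s > 0`, rescale `l` by `f s ^ α⁻¹`; the scaling formula needs a positive factor.
    rcases hs.eq_or_lt with h0 | h0
    · simp [← h0, Real.zero_rpow (div_pos hβ hα0).ne']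
    · have h2 := integral_comp_mul_mul_rpow (fun l => 1 - Real.exp (-(l ^ α))) β
        (Real.rpow_pos_of_pos h0 α⁻¹)
      rw [← Real.rpow_mul h0.le, inv_mul_eq_div] at h2
      rw [← h2]
      refine setIntegral_congr_fun measurableSet_Ioi fun l (hl : 0 < l) => ?_
      simp only [Real.mul_rpow (Real.rpow_nonneg h0.le _) hl.le, ← Real.rpow_mul h0.le,
        inv_mul_cancel₀ hα0.ne', Real.rpow_one]

/-- The point is that `m`, a ratio of two positive integrals, does not depend on `s`. -/
theorem exists_pos_forall_integral_abs_inner_rpow {μ : Measure E} [IsProbabilityMeasure μ]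
    {f : E → ℝ} {α β : ℝ} (hβ : 0 < β) (hβα : β < α) (hα : α ≤ 2)
    (hf : IsHomogeneousOfOrder α f) (hf0 : ∀ s, 0 ≤ f s)
    (hμ : ∀ s, ∫ x, Real.cos (inner ℝ s x) ∂μ = Real.exp (-f s)) :
    ∃ m : ℝ, 0 < m ∧ ∀ s, Integrable (fun x => |inner ℝ s x| ^ β) μ ∧
      f s ^ (β / α) = m * ∫ x, |inner ℝ s x| ^ β ∂μ := by
  have hk0 := integral_one_sub_cos_mul_rpow_pos hβ (hβα.trans_le hα)
  have hK0 : 0 < ∫ l in Set.Ioi (0 : ℝ), (1 - Real.exp (-(l ^ α))) * l ^ (-1 - β) :=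
    setIntegral_Ioi_mul_rpow_pos (F := fun l => 1 - Real.exp (-(l ^ α)))
      (fun l hl => sub_nonneg.2 (Real.exp_le_one_iff.2 (neg_nonpos.2 (Real.rpow_nonneg hl.le _))))
      (fun l hl _ => sub_pos.2 (Real.exp_lt_one_iff.2 (neg_lt_zero.2 (Real.rpow_pos_of_pos hl _))))
      (by simpa using integrableOn_one_sub_exp_mul_rpow hβ hβα zero_le_one)
  refine ⟨_, div_pos hk0 hK0, fun s => ?_⟩
  obtain ⟨h1, h2⟩ := integrable_and_integral_abs_inner_rpow hβ hβα hα hf (hf0 s) hμ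
  refine ⟨h1, ?_⟩
  rw [div_mul_eq_mul_div, h2, mul_div_cancel_right₀ _ hK0.ne']

end Moments

/-! ### The stable law and the spectral measure -/

theorem MemHPlus.nonneg {d : ℕ} {α : ℝ} {f : EuclideanSpace ℝ (Fin d) → ℝ} (hf : MemHPlus α f)
    (hα : 0 < α) (s : EuclideanSpace ℝ (Fin d)) : 0 ≤ f s := by
  rcases eq_or_ne s 0 with rfl | hs
  · exact (hf.homogeneous.map_zero hα).ge
  · exact (hf.pos s hs).le

theorem MemHPlus.exists_mul_norm_rpow_le {d : ℕ} {α : ℝ} {f : EuclideanSpace ℝ (Fin d) → ℝ}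
    (hf : MemHPlus α f) (hα : 0 < α) : ∃ c > 0, ∀ s, c * ‖s‖ ^ α ≤ f s := by
  -- Otherwise `c` is the minimum of `f` on the compact unit sphere; the sphere is empty only when
  -- `d = 0`.
  rcases (sphere (0 : EuclideanSpace ℝ (Fin d)) 1).eq_empty_or_nonempty with he | hne
  · refine ⟨1, one_pos, fun s => ?_⟩
    rcases eq_or_ne s 0 with rfl | hs
    · simp [Real.zero_rpow hα.ne', hf.homogeneous.map_zero hα]
    · have : ‖s‖⁻¹ • s ∈ sphere (0 : EuclideanSpace ℝ (Fin d)) 1 := by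
        simp [norm_smul, norm_ne_zero_iff.2 hs]
      simp [he] at this
  · obtain ⟨x, hx, hmin⟩ := (isCompact_sphere _ _).exists_isMinOn hne hf.continuous.continuousOn
    refine ⟨f x, hf.pos x (ne_zero_of_mem_unit_sphere ⟨x, hx⟩), fun s => ?_⟩
    rcases eq_or_ne s 0 with rfl | hs
    · simp [Real.zero_rpow hα.ne', hf.homogeneous.map_zero hα]
    · have hs' : ‖s‖ ≠ 0 := norm_ne_zero_iff.2 hs
      have h1 : f s = ‖s‖ ^ α * f (‖s‖⁻¹ • s) := by
        have := hf.homogeneous (‖s‖⁻¹ • s) ‖s‖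
        rwa [smul_smul, mul_inv_cancel₀ hs', one_smul, abs_norm] at this
      rw [h1, mul_comm]
      refine mul_le_mul_of_nonneg_left (hmin ?_) (Real.rpow_nonneg (norm_nonneg _) _)
      simp [norm_smul, hs']

theorem MemHPlus.integrable_exp_neg {d : ℕ} [NeZero d] {α : ℝ}
    {f : EuclideanSpace ℝ (Fin d) → ℝ} (hf : MemHPlus α f) (hα : 0 < α) :
    Integrable fun s => Real.exp (-f s) := by
  obtain ⟨c, hc, hcf⟩ := hf.exists_mul_norm_rpow_le hα
  have : Nontrivial (EuclideanSpace ℝ (Fin d)) :=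
    Module.nontrivial_of_finrank_pos (R := ℝ) (by simpa using NeZero.pos d)
  have h1 : Integrable fun s : EuclideanSpace ℝ (Fin d) => Real.exp (-c * ‖s‖ ^ α) := by
    rw [integrable_fun_norm_addHaar volume (f := fun r => Real.exp (-c * r ^ α))]
    have h2 := integrableOn_rpow_mul_exp_neg_mul_rpow (p := α) (b := c)
      (s := ((Module.finrank ℝ (EuclideanSpace ℝ (Fin d)) - 1 : ℕ) : ℝ))
      (neg_one_lt_zero.trans_le (Nat.cast_nonneg _)) hα hc
    simpa only [Real.rpow_natCast, smul_eq_mul] using h2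
  refine h1.mono' (Real.continuous_exp.comp hf.continuous.neg).aestronglyMeasurable
    (.of_forall fun s => ?_)
  rw [Real.norm_eq_abs, Real.abs_exp]
  exact Real.exp_le_exp.2 (by linarith [hcf s])

/-- The stable law with characteristic function `exp (-f)`. -/
theorem exists_isProbabilityMeasure_integral_cos_eq_exp_neg {d : ℕ} [NeZero d] {α : ℝ}
    {f : EuclideanSpace ℝ (Fin d) → ℝ} (hf : MemHPlus α f) (hα : 0 < α)
    (hneg : IsNegativeDefinite f) :
    ∃ μ : Measure (EuclideanSpace ℝ (Fin d)), IsProbabilityMeasure μ ∧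
      ∀ s, ∫ x, Real.cos (inner ℝ s x) ∂μ = Real.exp (-f s) :=
  exists_isProbabilityMeasure_integral_cos_eq (φ := fun s => Real.exp (-f s)) (B := 1)
    (Real.continuous_exp.comp hf.continuous.neg) (by simp [hneg.map_zero])
    (fun s => by simp [hneg.even])
    (fun s => by
      rw [Real.abs_exp]
      exact Real.exp_le_one_iff.2 (neg_nonpos.2 (hf.nonneg hα s)))
    (hf.integrable_exp_neg hα) hneg.posSemidef_exp_neg

/-- The ratios `|x i| / ‖x‖` are at most `1` and their squares sum to `1`; lowering the exponent
from `2` to `β` only increases them. -/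
theorem norm_rpow_le_sum_abs_inner_rpow {d : ℕ} {β : ℝ} (hβ : 0 < β) (hβ2 : β ≤ 2)
    (x : EuclideanSpace ℝ (Fin d)) :
    ‖x‖ ^ β ≤ ∑ i, |inner ℝ (EuclideanSpace.single i (1 : ℝ)) x| ^ β := by
  have e : ∀ i, inner ℝ (EuclideanSpace.single i (1 : ℝ)) x = x i := fun i => by
    simp [EuclideanSpace.inner_single_left]
  simp only [e]
  rcases eq_or_ne x 0 with rfl | hx
  · simp [Real.zero_rpow hβ.ne']
  have hx' : 0 < ‖x‖ := norm_pos_iff.2 hx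
  have h1 : ∀ i, ‖x‖ ^ β * (x i ^ 2 / ‖x‖ ^ 2) ≤ |x i| ^ β := fun i => by
    have h2 : |x i| / ‖x‖ ≤ 1 := (div_le_one hx').2 (by simpa using PiLp.norm_apply_le x i)
    have h3 : (|x i| / ‖x‖) ^ (2 : ℝ) ≤ (|x i| / ‖x‖) ^ β := by
      rcases (div_nonneg (abs_nonneg (x i)) hx'.le).eq_or_lt with h0 | h0
      · rw [← h0, Real.zero_rpow two_ne_zero, Real.zero_rpow hβ.ne']
      · exact Real.rpow_le_rpow_of_exponent_ge h0 h2 hβ2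
    rw [Real.rpow_two, div_pow, sq_abs, Real.div_rpow (abs_nonneg _) hx'.le] at h3
    calc _ ≤ ‖x‖ ^ β * (|x i| ^ β / ‖x‖ ^ β) :=
          mul_le_mul_of_nonneg_left h3 (Real.rpow_nonneg hx'.le _)
      _ = |x i| ^ β := mul_div_cancel₀ _ (Real.rpow_pos_of_pos hx' _).ne'
  refine le_trans (le_of_eq ?_) (Finset.sum_le_sum fun i _ => h1 i)
  rw [← Finset.mul_sum, ← Finset.sum_div, ← EuclideanSpace.real_norm_sq_eq,
    div_self (pow_pos hx' 2).ne', mul_one]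

/-- The spectral measure of order `β < α` obtained by projecting an `α`-stable law radially on the
unit sphere. -/
theorem exists_finiteMeasure_sphere_of_lt {d : ℕ} [NeZero d] {α β : ℝ}
    {f : EuclideanSpace ℝ (Fin d) → ℝ} (hf : MemHPlus α f) (hβ : 0 < β) (hβα : β < α)
    (hα : α ≤ 2) (hneg : IsNegativeDefinite f) :
    ∃ Γ : FiniteMeasure (sphere (0 : EuclideanSpace ℝ (Fin d)) 1), ∀ s,
      ∫ x, |inner ℝ s (x : EuclideanSpace ℝ (Fin d))| ^ β ∂Γ.toMeasure = f s ^ (β / α) := by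
  have hα0 : 0 < α := hβ.trans hβα
  obtain ⟨μ, hμ, hcos⟩ := exists_isProbabilityMeasure_integral_cos_eq_exp_neg hf hα0 hneg
  obtain ⟨m, hm, H⟩ := exists_pos_forall_integral_abs_inner_rpow hβ hβα hα hf.homogeneous
    (hf.nonneg hα0) hcos
  -- An arbitrary image for the origin, which the weight `m * ‖x‖ ^ β` gives no mass.
  let e₀ : sphere (0 : EuclideanSpace ℝ (Fin d)) 1 := ⟨EuclideanSpace.single 0 1, by simp⟩
  classical
  let p : EuclideanSpace ℝ (Fin d) → sphere (0 : EuclideanSpace ℝ (Fin d)) 1 := fun x =>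
    if hx : x = 0 then e₀ else ⟨‖x‖⁻¹ • x, by simp [norm_smul, norm_ne_zero_iff.2 hx]⟩
  have hp : ∀ x, x ≠ 0 → (p x : EuclideanSpace ℝ (Fin d)) = ‖x‖⁻¹ • x := fun x hx => by
    simp [p, hx]
  have hpm : Measurable p := by
    refine Measurable.subtype_mk (f := fun x => (p x : EuclideanSpace ℝ (Fin d))) (h := fun x =>
      (p x).2) ?_
    have : (fun x => (p x : EuclideanSpace ℝ (Fin d)))
        = fun x => if x = 0 then (e₀ : EuclideanSpace ℝ (Fin d)) else ‖x‖⁻¹ • x := by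
      funext x
      by_cases hx : x = 0
      · simp [p, hx]
      · simp [hp x hx, hx]
    rw [this]
    exact Measurable.ite (measurableSet_singleton 0) measurable_const (by fun_prop)
  have hw0 : ∀ x : EuclideanSpace ℝ (Fin d), 0 ≤ m * ‖x‖ ^ β := fun x =>
    mul_nonneg hm.le (Real.rpow_nonneg (norm_nonneg _) _)
  have hwi : Integrable (fun x => m * ‖x‖ ^ β) μ := by
    refine Integrable.const_mul ?_ m
    refine Integrable.mono' (integrable_finsetSum Finset.univ fun i _ =>
      (H (EuclideanSpace.single i 1)).1)
      (measurable_norm.pow_const β).aestronglyMeasurable (.of_forall fun x => ?_)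
    rw [Real.norm_eq_abs, abs_of_nonneg (Real.rpow_nonneg (norm_nonneg _) _)]
    exact norm_rpow_le_sum_abs_inner_rpow hβ (hβα.le.trans hα) x
  let ν := μ.withDensity fun x => ENNReal.ofReal (m * ‖x‖ ^ β)
  have hν : IsFiniteMeasure ν := isFiniteMeasure_withDensity_ofReal hwi.2
  refine ⟨⟨ν.map p, inferInstance⟩, fun s => ?_⟩
  rw [FiniteMeasure.toMeasure_mk, integral_map hpm.aemeasurable
      (by fun_prop : Measurable _).aestronglyMeasurable,
    integral_withDensity_eq_integral_toReal_smul (by fun_prop) (.of_forall fun _ => by simp),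
    (H s).2, ← integral_const_mul]
  refine integral_congr_ae (.of_forall fun x => ?_)
  simp only [ENNReal.toReal_ofReal (hw0 x), smul_eq_mul]
  rcases eq_or_ne x 0 with rfl | hx
  · simp [Real.zero_rpow hβ.ne']
  have hx' : 0 < ‖x‖ := norm_pos_iff.2 hx
  rw [hp x hx, real_inner_smul_right, abs_mul, abs_of_pos (inv_pos.2 hx'),
    Real.mul_rpow (inv_pos.2 hx').le (abs_nonneg _), Real.inv_rpow hx'.le, mul_assoc,
    mul_inv_cancel_left₀ (Real.rpow_pos_of_pos hx' _).ne']

theorem integrable_abs_inner_rpow_sphere {d : ℕ} {β : ℝ} (hβ : 0 < β)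
    (Γ : Measure (sphere (0 : EuclideanSpace ℝ (Fin d)) 1)) [IsFiniteMeasure Γ]
    (s : EuclideanSpace ℝ (Fin d)) :
    Integrable (fun x : sphere (0 : EuclideanSpace ℝ (Fin d)) 1 =>
      |inner ℝ s (x : EuclideanSpace ℝ (Fin d))| ^ β) Γ := by
  refine Continuous.integrable_of_hasCompactSupport ?_ (HasCompactSupport.of_compactSpace _)
  exact (by fun_prop : Continuous fun x : sphere (0 : EuclideanSpace ℝ (Fin d)) 1 =>
    |inner ℝ s (x : EuclideanSpace ℝ (Fin d))|).rpow_const fun _ => .inr hβ.le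

/-- Bounds the mass by the represented function at the basis vectors, which gives compactness as `β
↑ α`. -/
theorem measureReal_univ_le_sum_integral_abs_inner_rpow {d : ℕ} {β : ℝ} (hβ : 0 < β) (hβ2 : β ≤ 2)
    (Γ : Measure (sphere (0 : EuclideanSpace ℝ (Fin d)) 1)) [IsFiniteMeasure Γ] :
    Γ.real Set.univ ≤ ∑ i, ∫ x, |inner ℝ (EuclideanSpace.single i (1 : ℝ))
      (x : EuclideanSpace ℝ (Fin d))| ^ β ∂Γ := by
  rw [← integral_finsetSum _ fun i _ => integrable_abs_inner_rpow_sphere hβ Γ _]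
  calc Γ.real Set.univ = ∫ _, (1 : ℝ) ∂Γ := by simp
    _ ≤ _ := integral_mono (integrable_const _) (integrable_finsetSum _ fun i _ =>
      integrable_abs_inner_rpow_sphere hβ Γ _) fun x => by
        simpa using norm_rpow_le_sum_abs_inner_rpow hβ hβ2 (x : EuclideanSpace ℝ (Fin d))

theorem tendstoUniformly_abs_inner_rpow {d : ℕ} {α : ℝ} (hα : 0 < α)
    (s : EuclideanSpace ℝ (Fin d)) :
    TendstoUniformly (fun (β : ℝ) (x : sphere (0 : EuclideanSpace ℝ (Fin d)) 1) =>
        |inner ℝ s (x : EuclideanSpace ℝ (Fin d))| ^ β)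
      (fun x => |inner ℝ s (x : EuclideanSpace ℝ (Fin d))| ^ α) (𝓝 α) := by
  refine ContinuousOn.tendstoUniformly (U := Set.Ioi 0) (Ioi_mem_nhds hα) ?_
  refine ContinuousOn.rpow (f := fun z : ℝ × sphere (0 : EuclideanSpace ℝ (Fin d)) 1 =>
      |inner ℝ s (z.2 : EuclideanSpace ℝ (Fin d))|) (g := fun z => z.1)
    (by fun_prop) (by fun_prop) fun z hz => .inr hz.1

/-- **Spectral representation**: a negative definite function in `H⁺(α)` is an integral of functions
`s ↦ |⟨s, x⟩|^α` over the unit sphere. -/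
theorem exists_finiteMeasure_sphere_integral_eq {d : ℕ} [NeZero d] {α : ℝ}
    {f : EuclideanSpace ℝ (Fin d) → ℝ} (hf : MemHPlus α f) (hα0 : 0 < α) (hα : α ≤ 2)
    (hneg : IsNegativeDefinite f) :
    ∃ Γ : FiniteMeasure (sphere (0 : EuclideanSpace ℝ (Fin d)) 1), ∀ s,
      f s = ∫ x, |inner ℝ s (x : EuclideanSpace ℝ (Fin d))| ^ α ∂Γ.toMeasure := by
  have hex : ∀ β : ℝ, ∃ Γ : FiniteMeasure (sphere (0 : EuclideanSpace ℝ (Fin d)) 1),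
      0 < β → β < α → ∀ s,
      ∫ x, |inner ℝ s (x : EuclideanSpace ℝ (Fin d))| ^ β ∂Γ.toMeasure = f s ^ (β / α) :=
    fun β => by
    by_cases h : 0 < β ∧ β < α
    · obtain ⟨Γ, hΓ⟩ := exists_finiteMeasure_sphere_of_lt hf h.1 h.2 hα hneg
      exact ⟨Γ, fun _ _ => hΓ⟩
    · exact ⟨0, fun h1 h2 => (h ⟨h1, h2⟩).elim⟩
  choose G hG using hex
  -- Bounds the masses uniformly in `β`, as `y ^ (β / α) ≤ 1 + y` for `y ≥ 0` and `0 < β < α`.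
  let M : ℝ := ∑ i : Fin d, (1 + f (EuclideanSpace.single i 1))
  have hM : 0 ≤ M := Finset.sum_nonneg fun i _ => add_nonneg zero_le_one (hf.nonneg hα0 _)
  have hmass : ∀ β, 0 < β → β < α → (G β).toMeasure.real Set.univ ≤ M := fun β h1 h2 => by
    refine (measureReal_univ_le_sum_integral_abs_inner_rpow h1 (h2.le.trans hα) _).trans ?_
    refine Finset.sum_le_sum fun i _ => ?_
    rw [hG β h1 h2]
    have h0 := hf.nonneg hα0 (EuclideanSpace.single i 1)
    rcases le_total (f (EuclideanSpace.single i 1)) 1 with h | h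
    · linarith [Real.rpow_le_one h0 h (div_pos h1 hα0).le]
    · have := Real.rpow_le_rpow_of_exponent_le h ((div_le_one hα0).2 h2.le)
      rw [Real.rpow_one] at this
      linarith
  have hev : ∀ᶠ β in 𝓝[<] α, 0 < β ∧ β < α := by
    filter_upwards [Ioo_mem_nhdsLT hα0] with β hβ using hβ
  -- Along an ultrafilter finer than `𝓝[<] α`, compactness gives a limit without extracting
  -- subsequences.
  let U : Ultrafilter ℝ := Ultrafilter.of (𝓝[<] α)
  have hU : (U : Filter ℝ) ≤ 𝓝[<] α := Ultrafilter.of_le _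
  have hU' : (U : Filter ℝ) ≤ 𝓝 α := hU.trans nhdsWithin_le_nhds
  obtain ⟨Γ, -, hΓ⟩ := isCompact_iff_ultrafilter_le_nhds.1
    (isCompact_setOfPred_finiteMeasure_le_of_compactSpace
      (sphere (0 : EuclideanSpace ℝ (Fin d)) 1) ⟨M, hM⟩) (U.map G) (by
      rw [le_principal_iff, Ultrafilter.coe_map, Filter.mem_map]
      filter_upwards [hU hev] with β hβ using hmass β hβ.1 hβ.2)
  have hlim : Tendsto G U (𝓝 Γ) := hΓ
  refine ⟨Γ, fun s => ?_⟩
  let g : BoundedContinuousFunction (sphere (0 : EuclideanSpace ℝ (Fin d)) 1) ℝ :=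
    BoundedContinuousFunction.mkOfCompact ⟨fun x => |inner ℝ s (x : EuclideanSpace ℝ (Fin d))| ^ α,
      (by fun_prop : Continuous fun x : sphere (0 : EuclideanSpace ℝ (Fin d)) 1 =>
        |inner ℝ s (x : EuclideanSpace ℝ (Fin d))|).rpow_const fun _ => .inr hα0.le⟩
  have h1 : Tendsto (fun β => ∫ x, |inner ℝ s (x : EuclideanSpace ℝ (Fin d))| ^ α
      ∂(G β).toMeasure) U (𝓝 (∫ x, |inner ℝ s (x : EuclideanSpace ℝ (Fin d))| ^ α
      ∂Γ.toMeasure)) :=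
    FiniteMeasure.tendsto_iff_forall_integral_tendsto.1 hlim g
  -- Integrand and measure both vary with `β`. Uniform convergence on the sphere and bounded mass
  -- allow the exponent to be replaced by `α`; `M + 1` avoids dividing by zero.
  have h2 : Tendsto (fun β => ∫ x, |inner ℝ s (x : EuclideanSpace ℝ (Fin d))| ^ β
      ∂(G β).toMeasure - ∫ x, |inner ℝ s (x : EuclideanSpace ℝ (Fin d))| ^ α
      ∂(G β).toMeasure) U (𝓝 0) := by
    rw [Metric.tendsto_nhds]
    intro ε hε
    have hδ : 0 < ε / (M + 1) := div_pos hε (by linarith)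
    filter_upwards [hU hev, hU' (Metric.tendstoUniformly_iff.1
      (tendstoUniformly_abs_inner_rpow hα0 s) _ hδ)] with β hβ hβu
    rw [dist_zero_right, ← integral_sub (integrable_abs_inner_rpow_sphere hβ.1 _ s)
      (integrable_abs_inner_rpow_sphere hα0 _ s)]
    have h3 := norm_integral_le_of_norm_le_const (μ := (G β).toMeasure) (C := ε / (M + 1))
      (f := fun x => |inner ℝ s (x : EuclideanSpace ℝ (Fin d))| ^ β
        - |inner ℝ s (x : EuclideanSpace ℝ (Fin d))| ^ α)
      (.of_forall fun x => by
        have := (hβu x).le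
        rwa [dist_comm, Real.dist_eq] at this)
    refine h3.trans_lt ?_
    have h4 := mul_le_mul_of_nonneg_left (hmass β hβ.1 hβ.2) hδ.le
    refine h4.trans_lt ?_
    rw [div_mul_eq_mul_div, div_lt_iff₀ (by linarith)]
    nlinarith
  have h3 : Tendsto (fun β => f s ^ (β / α)) U (𝓝 (f s)) := by
    have hc : ContinuousAt (fun β : ℝ => f s ^ (β / α)) α :=
      ContinuousAt.comp (g := fun b : ℝ => f s ^ b) (f := fun β : ℝ => β / α)
        (Real.continuousAt_const_rpow' (div_pos hα0 hα0).ne') (by fun_prop)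
    have := hc.tendsto.mono_left hU'
    simpa only [div_self hα0.ne', Real.rpow_one] using this
  have h4 := h2.add h1
  simp only [sub_add_cancel, zero_add] at h4
  refine tendsto_nhds_unique h3 (h4.congr' ?_)
  filter_upwards [hU hev] with β hβ
  exact hG β hβ.1 hβ.2 s

theorem not_image_support_subset_of_integral_pos {d : ℕ} {α : ℝ} (hα : 0 < α)
    (Γ : Measure (sphere (0 : EuclideanSpace ℝ (Fin d)) 1))
    (h : ∀ s : EuclideanSpace ℝ (Fin d), s ≠ 0 →
      ∫ x, |inner ℝ s (x : EuclideanSpace ℝ (Fin d))| ^ α ∂Γ ≠ 0)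
    {V : Submodule ℝ (EuclideanSpace ℝ (Fin d))} (hV : V ≠ ⊤) :
    ¬ ((↑) '' Γ.support ⊆ (V : Set (EuclideanSpace ℝ (Fin d)))) := by
  intro hsub
  -- For nonzero `s` orthogonal to `V` the integrand vanishes on the support, hence almost
  -- everywhere.
  obtain ⟨s, hs, hs0⟩ := Submodule.exists_mem_ne_zero_of_ne_bot
    (mt (Submodule.orthogonal_eq_bot_iff (K := V)).1 hV)
  refine h s hs0 (integral_eq_zero_of_ae ?_)
  filter_upwards [Measure.support_mem_ae (μ := Γ)] with x hx
  have hxV : (x : EuclideanSpace ℝ (Fin d)) ∈ V := hsub ⟨x, hx, rfl⟩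
  have : inner ℝ s (x : EuclideanSpace ℝ (Fin d)) = 0 := V.inner_left_of_mem_orthogonal hxV hs
  simp [this, Real.zero_rpow hα.ne']

theorem mainTheorem9 {Ω : Type*} [MeasurableSpace Ω] (P : Measure Ω) [IsProbabilityMeasure P]
    {d : ℕ} (D : Set (EuclideanSpace ℝ (Fin d))) (hD : IsOpen D) (α : ℝ)
    (X : D → Ω → ℝ) (C : D → EuclideanSpace ℝ (Fin d) → ℝ)
    (hX : IsLocallyStationary P X α C) (t : D) :
    IsNegativeDefinite (C t) ∧
      ∃ Γ : Measure (sphere (0 : EuclideanSpace ℝ (Fin d)) 1),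
        IsFiniteMeasure Γ ∧
        (∀ s : EuclideanSpace ℝ (Fin d),
          C t s = ∫ x, |inner ℝ s (x : EuclideanSpace ℝ (Fin d))| ^ α ∂Γ) ∧
        ∀ V : Submodule ℝ (EuclideanSpace ℝ (Fin d)), V ≠ ⊤ →
          ¬ ((↑) '' Γ.support ⊆ (V : Set (EuclideanSpace ℝ (Fin d)))) := by
  have hneg := hX.isNegativeDefinite hD t
  have hC := hX.memHPlus t
  refine ⟨hneg, ?_⟩
  suffices h : ∃ Γ : FiniteMeasure (sphere (0 : EuclideanSpace ℝ (Fin d)) 1), ∀ s,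
      C t s = ∫ x, |inner ℝ s (x : EuclideanSpace ℝ (Fin d))| ^ α ∂Γ.toMeasure by
    obtain ⟨Γ, hΓ⟩ := h
    exact ⟨Γ, inferInstance, hΓ, fun V hV => not_image_support_subset_of_integral_pos hX.index_pos _
      (fun s hs => hΓ s ▸ (hC.pos s hs).ne') hV⟩
  -- For `d = 0` the sphere is empty and `C t` is zero, so the zero measure works.
  rcases Nat.eq_zero_or_pos d with rfl | hd
  · exact ⟨0, fun s => by simp [Subsingleton.elim s 0, hneg.map_zero]⟩
  · have : NeZero d := ⟨hd.ne'⟩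
    exact exists_finiteMeasure_sphere_integral_eq hC hX.index_pos hX.index_le_two hneg
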